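/- Let $M=\mathbb R^n/\Gamma$ be an infratorus, i.e. a closed flat Riemannian manifold, presented as the quotient of its universal cover $\mathbb R^n$ by a group $\Gamma$ of isometries acting freely and properly discontinuously with compact quotient. Let $L\colon M\to M$ be an Anosov automorphism, i.e. a map induced by an affine bijection $\tilde L(x)=Ax+x_0$ of $\mathbb R^n$ with $\tilde L\,\Gamma\,\tilde L^{-1}=\Gamma$ such that no complex eigenvalue of $A$ has absolute value $1$. Then there are an integer $k\ge 1$ and a map $E\colon M\to M$ such that (i) $E$ is a conformal expanding affine transformation of $M$, i.e. it is induced by an affine bijection $\tilde E(x)=Bx+v$ of $\mathbb R^n$ with $\tilde E\,\Gamma\,\tilde E^{-1}\subseteq\Gamma$, where all complex eigenvalues of $B$ have absolute value greater than $1$ and $B$ is a nonzero scalar multiple of a linear isometry of $\mathbb R^n$; (ii) $E\circ L^k=L^k\circ E$; (iii) $E$ and $L^k$ have a common fixed point: there is $p\in M$ with $E(p)=p$ and $L^k(p)=p$. -/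

import Mathlib

namespace FlatManifold

/-- Euclidean `n`-space. -/
abbrev Euc (n : ℕ) : Type := EuclideanSpace ℝ (Fin n)

/-- The group of isometries of Euclidean `n`-space. -/
abbrev EucIsom (n : ℕ) : Type := Euc n ≃ᵃⁱ[ℝ] Euc n

/-- Isometries of Euclidean space act on it by evaluation. -/
noncomputable instance instMulActionEucIsom (n : ℕ) : MulAction (EucIsom n) (Euc n) where
  smul γ x := γ x
  one_smul _ := rfl
  mul_smul _ _ _ := rfl

theorem eucIsom_smul_def {n : ℕ} (γ : EucIsom n) (x : Euc n) : γ • x = γ x := rfl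

/-- The orbit space `ℝⁿ / Γ`, with the quotient topology. -/
abbrev OrbitSpace {n : ℕ} (Γ : Subgroup (EucIsom n)) : Type :=
  MulAction.orbitRel.Quotient Γ (Euc n)

/-- The projection `ℝⁿ → ℝⁿ / Γ`. -/
noncomputable def proj {n : ℕ} (Γ : Subgroup (EucIsom n)) (x : Euc n) : OrbitSpace Γ :=
  Quotient.mk (MulAction.orbitRel Γ (Euc n)) x

/-- `ℝⁿ / Γ` is a closed flat Riemannian manifold (an infratorus) with universal covering
`ℝⁿ → ℝⁿ / Γ`: the group `Γ` of isometries acts freely and properly discontinuously, and the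
orbit space is compact. -/
structure IsInfratorus {n : ℕ} (Γ : Subgroup (EucIsom n)) : Prop where
  free : ∀ γ ∈ Γ, ∀ x : Euc n, γ x = x → γ = 1
  properlyDiscontinuous : ProperlyDiscontinuousSMul Γ (Euc n)
  compact : CompactSpace (OrbitSpace Γ)

/-- The linear map `T` is hyperbolic: no complex eigenvalue has absolute value `1`. -/
def IsHyperbolic {n : ℕ} (T : Euc n →ₗ[ℝ] Euc n) : Prop :=
  ∀ z : ℂ, (T.charpoly.map (algebraMap ℝ ℂ)).IsRoot z → ‖z‖ ≠ 1

/-- The linear map `T` is expanding: all complex eigenvalues have absolute value greater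
than `1`. -/
def IsExpanding {n : ℕ} (T : Euc n →ₗ[ℝ] Euc n) : Prop :=
  ∀ z : ℂ, (T.charpoly.map (algebraMap ℝ ℂ)).IsRoot z → 1 < ‖z‖

/-- `F Γ F⁻¹ ⊆ Γ`. -/
def ConjMapsInto {n : ℕ} (Γ : Subgroup (EucIsom n)) (F : Euc n ≃ᵃ[ℝ] Euc n) : Prop :=
  ∀ γ ∈ Γ, ∃ γ' ∈ Γ, ∀ x : Euc n, F (γ (F.symm x)) = γ' x

/-- `F Γ F⁻¹ = Γ`. -/
def Normalizes {n : ℕ} (Γ : Subgroup (EucIsom n)) (F : Euc n ≃ᵃ[ℝ] Euc n) : Prop :=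
  ConjMapsInto Γ F ∧ ∀ γ' ∈ Γ, ∃ γ ∈ Γ, ∀ x : Euc n, F (γ (F.symm x)) = γ' x

/-- The self-map `f` of `ℝⁿ / Γ` is covered by the affine map `F`. -/
def IsInducedBy {n : ℕ} {Γ : Subgroup (EucIsom n)} (f : OrbitSpace Γ → OrbitSpace Γ)
    (F : Euc n ≃ᵃ[ℝ] Euc n) : Prop :=
  ∀ x : Euc n, f (proj Γ x) = proj Γ (F x)

/-- `L` is an Anosov automorphism of `ℝⁿ / Γ`: it is induced by an affine map of `ℝⁿ` which
normalizes `Γ` and has hyperbolic linear part. -/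
def IsAnosovAutomorphism {n : ℕ} {Γ : Subgroup (EucIsom n)}
    (L : OrbitSpace Γ → OrbitSpace Γ) : Prop :=
  ∃ F : Euc n ≃ᵃ[ℝ] Euc n,
    IsHyperbolic (F.linear : Euc n →ₗ[ℝ] Euc n) ∧ Normalizes Γ F ∧ IsInducedBy L F

/-- `f` is a conformal expanding affine transformation of `ℝⁿ / Γ`: it is induced by an affine
map `F` of `ℝⁿ` with `F Γ F⁻¹ ⊆ Γ` whose linear part is expanding and conformal. Since
`ℝⁿ → ℝⁿ / Γ` is a Riemannian covering, `f` is conformal exactly when `F` is. -/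
def IsConformalExpandingAffine {n : ℕ} {Γ : Subgroup (EucIsom n)}
    (f : OrbitSpace Γ → OrbitSpace Γ) : Prop :=
  ∃ F : Euc n ≃ᵃ[ℝ] Euc n,
    IsExpanding (F.linear : Euc n →ₗ[ℝ] Euc n) ∧
    IsConformalMap (LinearMap.toContinuousLinearMap (F.linear : Euc n →ₗ[ℝ] Euc n)) ∧
    ConjMapsInto Γ F ∧ IsInducedBy f F

end FlatManifold

/-! Hyperbolicity gives the affine lift `F` of `L` a fixed point `p`. The map `E` is induced by a
homothety centred at `p`: it commutes with every affine map fixing `p`, and it conjugates `Γ` into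
itself once its ratio is `N + 1` with `N • (γ p - p)` in the translation lattice for all `γ ∈ Γ`.

Such an `N` exists by `exists_nsmul_displacement_mem`. The point group is finite, so a power `T ^ k`
of the linear part of `F` centralizes it. Hence `γ` and its conjugate by `F ^ k` differ by a
translation, which says `(T ^ k - 1) (γ p - p)` lies in the lattice. As `T ^ k - 1` is injective, it
maps the lattice onto a subgroup of finite index, which bounds the denominators.

Finiteness of the point group is Bieberbach's theorem, proved by iterating commutators: they
contract linear parts near the identity while displacements stay bounded, so discreteness forces
them to become trivial (`rot_commute_of_isNear`, `rot_eq_one_of_isNear`). -/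

namespace FlatManifold

open scoped commutatorElement

/-! ### Linear isometries near the identity -/

section LinearIsometries

variable {V : Type*} [NormedAddCommGroup V] [NormedSpace ℝ V]

/-- The linear isometry `g` is at distance at most `r` from the identity. -/
def IsNear (r : ℝ) (g : V ≃ₗᵢ[ℝ] V) : Prop := ∀ x, ‖g x - x‖ ≤ r * ‖x‖

theorem IsNear.mono {r s : ℝ} {g : V ≃ₗᵢ[ℝ] V} (h : IsNear r g) (hrs : r ≤ s) : IsNear s g :=
  fun x => (h x).trans (by gcongr)

theorem IsNear.conj {r : ℝ} {h : V ≃ₗᵢ[ℝ] V} (hh : IsNear r h) (g : V ≃ₗᵢ[ℝ] V) :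
    IsNear r (g * h * g⁻¹) := by
  intro x
  have h1 : (g * h * g⁻¹) x - x = g (h (g⁻¹ x) - g⁻¹ x) := by
    rw [map_sub]
    change _ = g (h (g⁻¹ x)) - (g * g⁻¹) x
    rw [mul_inv_cancel]; rfl
  have h2 : ‖g⁻¹ x‖ = ‖x‖ := (g⁻¹).norm_map x
  rw [h1, g.norm_map, ← h2]
  exact hh _

/-- The deviation from commuting of two linear isometries that are near the identity. -/
theorem norm_commutator_apply_le {a b : ℝ} {g h : V ≃ₗᵢ[ℝ] V} (ha : 0 ≤ a) (hb : 0 ≤ b)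
    (hg : IsNear a g) (hh : IsNear b h) (y : V) : ‖g (h y) - h (g y)‖ ≤ 2 * a * b * ‖y‖ := by
  have e : g (h y) - h (g y) = (g (h y - y) - (h y - y)) - (h (g y - y) - (g y - y)) := by
    simp only [map_sub]; abel
  rw [e]
  calc _ ≤ _ := norm_sub_le _ _
    _ ≤ a * (b * ‖y‖) + b * (a * ‖y‖) := by
      gcongr
      · exact (hg _).trans (by gcongr; exact hh y)
      · exact (hh _).trans (by gcongr; exact hg y)
    _ = _ := by ring

/-- `⁅g, h⁆ - 1 = (g h - h g) (h g)⁻¹`, and `(h g)⁻¹` preserves norms. -/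
theorem IsNear.commutator {a b : ℝ} {g h : V ≃ₗᵢ[ℝ] V} (ha : 0 ≤ a) (hb : 0 ≤ b)
    (hg : IsNear a g) (hh : IsNear b h) : IsNear (2 * a * b) ⁅g, h⁆ := by
  intro x
  have h1 : ⁅g, h⁆ x = g (h ((h * g)⁻¹ x)) := by
    rw [mul_inv_rev]; rfl
  have h2 : x = h (g ((h * g)⁻¹ x)) := by
    change x = ((h * g) * (h * g)⁻¹) x
    rw [mul_inv_cancel]; rfl
  have h3 : ‖(h * g)⁻¹ x‖ = ‖x‖ := ((h * g)⁻¹).norm_map x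
  rw [h1, ← h3]
  conv_lhs => rw [h2]
  simpa only [← h2] using norm_commutator_apply_le ha hb hg hh ((h * g)⁻¹ x)

theorem nonpos_of_forall_nat_mul_le {a b : ℝ} (h : ∀ N : ℕ, N * a ≤ b) : a ≤ 0 := by
  by_contra! ha
  obtain ⟨N, hN⟩ := exists_nat_gt (b / a)
  rw [div_lt_iff₀ ha] at hN
  exact absurd (h N) (not_le.2 hN)

/-- If `g` commutes with its commutator with `h`, and `h` is near the identity, then `g` commutes
with `h`. -/
theorem commutator_eq_one_of_commute {r : ℝ} (hr : r < 1) {g h : V ≃ₗᵢ[ℝ] V} (hh : IsNear r h)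
    (hc : Commute g ⁅g, h⁆) : ⁅g, h⁆ = 1 := by
  set c := ⁅g, h⁆ with hcdef
  have hch : c * h = g * h * g⁻¹ := by rw [hcdef, commutatorElement_def]; group
  have hpow : ∀ j : ℕ, c ^ j * h = g ^ j * h * (g ^ j)⁻¹ := by
    intro j
    induction j with
    | zero => simp
    | succ j ih =>
      have hcg : c ^ j * g = g * c ^ j := (hc.pow_right j).eq.symm
      calc c ^ (j + 1) * h = c ^ j * (c * h) := by rw [pow_succ, mul_assoc]
        _ = (c ^ j * g) * h * g⁻¹ := by rw [hch]; simp only [mul_assoc]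
        _ = g * (c ^ j * h) * g⁻¹ := by rw [hcg]; simp only [mul_assoc]
        _ = _ := by rw [ih, pow_succ']; group
  ext z
  set y := c z - z with hy
  -- The increments `c ^ j y` of the bounded sequence `c ^ j z` all lie within `r * ‖y‖` of the
  -- single vector `h⁻¹ y`, because `c ^ j * h` is conjugate to `h`. For `r < 1` they would add up
  -- linearly unless `y = 0`.
  have key : ∀ N : ℕ, N * ((1 - r) * ‖y‖) ≤ 2 * ‖z‖ := by
    intro N
    have hxy : h (h⁻¹ y) = y := by
      change (h * h⁻¹) y = y
      rw [mul_inv_cancel]; rfl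
    have hn : ‖h⁻¹ y‖ = ‖y‖ := (h⁻¹).norm_map y
    have h1 : ∀ j : ℕ, ‖(c ^ (j + 1)) z - (c ^ j) z - h⁻¹ y‖ ≤ r * ‖y‖ := by
      intro j
      have := hpow j ▸ hh.conj (g ^ j) (h⁻¹ y)
      rw [hn] at this
      have e : (c ^ j * h) (h⁻¹ y) = (c ^ (j + 1)) z - (c ^ j) z := by
        change (c ^ j) (h (h⁻¹ y)) = _
        rw [hxy, hy, map_sub, pow_succ]; rfl
      rwa [e] at this
    have h2 : (c ^ N) z - z - (N : ℝ) • h⁻¹ y =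
        ∑ j ∈ Finset.range N, ((c ^ (j + 1)) z - (c ^ j) z - h⁻¹ y) := by
      rw [Finset.sum_sub_distrib, Finset.sum_range_sub (fun j => (c ^ j) z)]
      simp [← Nat.cast_smul_eq_nsmul ℝ]
    have h3 : ‖(c ^ N) z - z - (N : ℝ) • h⁻¹ y‖ ≤ N * (r * ‖y‖) := by
      rw [h2]
      refine (norm_sum_le_of_le _ fun j _ => h1 j).trans ?_
      simp
    have h4 : ‖(N : ℝ) • h⁻¹ y‖ = N * ‖y‖ := by rw [norm_smul, hn]; simp
    have h5 : ‖(c ^ N) z - z‖ ≤ 2 * ‖z‖ := by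
      refine (norm_sub_le _ _).trans ?_
      rw [(c ^ N).norm_map]; linarith
    have h6 := norm_sub_norm_le ((N : ℝ) • h⁻¹ y) ((c ^ N) z - z)
    rw [norm_sub_rev _ ((c ^ N) z - z)] at h6
    linarith
  have h0 := nonpos_of_forall_nat_mul_le key
  have : ‖y‖ ≤ 0 := by nlinarith [norm_nonneg y]
  exact sub_eq_zero.1 (norm_le_zero_iff.1 this)

/-- A linear isometry has no nontrivial Jordan block with eigenvalue `1`. -/
theorem fixed_of_fixed_sub (g : V ≃ₗᵢ[ℝ] V) {x : V} (h : g (g x - x) = g x - x) : g x = x := by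
  have h1 : ∀ N : ℕ, (g ^ N) x = x + (N : ℝ) • (g x - x) := by
    intro N
    induction N with
    | zero => simp
    | succ N ih =>
      rw [pow_succ']
      change g ((g ^ N) x) = _
      rw [ih, map_add, map_smul, h]
      push_cast
      module
  have h2 : ∀ N : ℕ, N * ‖g x - x‖ ≤ 2 * ‖x‖ := by
    intro N
    have e : ‖(N : ℝ) • (g x - x)‖ = N * ‖g x - x‖ := by rw [norm_smul]; simp
    have e' : (N : ℝ) • (g x - x) = (g ^ N) x - x := by rw [h1]; abel
    rw [← e, e']
    refine (norm_sub_le _ _).trans ?_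
    rw [(g ^ N).norm_map]; linarith
  exact sub_eq_zero.1 (norm_le_zero_iff.1 (nonpos_of_forall_nat_mul_le h2))

end LinearIsometries

/-! ### Linear parts, translations and displacements in `Γ` -/

variable {n : ℕ}

/-- The linear part of an isometry of Euclidean space. -/
noncomputable def rot (n : ℕ) : EucIsom n →* (Euc n ≃ₗᵢ[ℝ] Euc n) where
  toFun γ := γ.linearIsometryEquiv
  map_one' := rfl
  map_mul' _ _ := rfl

theorem rot_sub (γ : EucIsom n) (x y : Euc n) : rot n γ (x - y) = γ x - γ y :=
  γ.map_vsub x y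

theorem apply_eq_rot_add (γ : EucIsom n) (x y : Euc n) : γ x = rot n γ (x - y) + γ y := by
  rw [rot_sub]; abel

/-- The translation by `v`. -/
noncomputable def transl (v : Euc n) : EucIsom n := AffineIsometryEquiv.constVAdd ℝ (Euc n) v

@[simp] theorem transl_apply (v x : Euc n) : transl v x = v + x := rfl

theorem eq_transl_of_rot_eq_one {γ : EucIsom n} (h : rot n γ = 1) (p : Euc n) :
    γ = transl (γ p - p) := by
  ext1 x
  rw [apply_eq_rot_add γ x p, h, transl_apply]
  change x - p + γ p = _
  abel

/-- The translations contained in `Γ`. -/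
noncomputable def translations (Γ : Subgroup (EucIsom n)) : AddSubgroup (Euc n) where
  carrier := {v | transl v ∈ Γ}
  zero_mem' := by
    have : (transl 0 : EucIsom n) = 1 := AffineIsometryEquiv.constVAdd_zero
    simp [this, Γ.one_mem]
  add_mem' {v w} hv hw := by
    have : transl (v + w) = transl v * transl w := by
      ext1 x; simp [add_assoc]
    simpa [this] using Γ.mul_mem hv hw
  neg_mem' {v} hv := by
    have : transl (-v) = (transl v)⁻¹ := by
      rw [eq_inv_iff_mul_eq_one]
      ext1 x; simp
    simpa [this] using Γ.inv_mem hv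

theorem mem_translations {Γ : Subgroup (EucIsom n)} {v : Euc n} :
    v ∈ translations Γ ↔ transl v ∈ Γ := Iff.rfl

theorem sub_mem_translations {Γ : Subgroup (EucIsom n)} {γ : EucIsom n} (hγ : γ ∈ Γ)
    (h : rot n γ = 1) (p : Euc n) : γ p - p ∈ translations Γ := by
  rw [mem_translations, ← eq_transl_of_rot_eq_one h]; exact hγ

theorem rot_apply_mem_translations {Γ : Subgroup (EucIsom n)} {γ : EucIsom n} (hγ : γ ∈ Γ)
    {v : Euc n} (hv : v ∈ translations Γ) : rot n γ v ∈ translations Γ := by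
  have : transl (rot n γ v) = γ * transl v * γ⁻¹ := by
    rw [eq_mul_inv_iff_mul_eq]
    ext1 x
    change rot n γ v + γ x = γ (v + x)
    rw [apply_eq_rot_add γ (v + x) x, add_sub_cancel_right]
  rw [mem_translations, this]
  exact Γ.mul_mem (Γ.mul_mem hγ hv) (Γ.inv_mem hγ)

/-- Only finitely many elements of `Γ` move `p` by a bounded amount. -/
def FiniteDisplacement (Γ : Subgroup (EucIsom n)) (p : Euc n) : Prop :=
  ∀ R : ℝ, {γ : EucIsom n | γ ∈ Γ ∧ ‖γ p - p‖ ≤ R}.Finite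

/-- The orbit of `p` is `d`-dense for some `d`. -/
def CoboundedOrbit (Γ : Subgroup (EucIsom n)) (p : Euc n) : Prop :=
  ∃ d : ℝ, ∀ x : Euc n, ∃ γ ∈ Γ, ‖γ p - x‖ ≤ d

variable {Γ : Subgroup (EucIsom n)} {p : Euc n}

/-- The displacement of `p` under a commutator. -/
theorem commutator_displacement (γ β : EucIsom n) (p q : Euc n) (hq : β (γ q) = p) :
    ⁅γ, β⁆ p - p = (rot n γ (β p - p) - (β p - p)) - (rot n β (γ p - p) - (γ p - p))
      + (rot n γ (rot n β (q - p)) - rot n β (rot n γ (q - p))) := by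
  have h1 : ⁅γ, β⁆ p = γ (β q) := by
    have : (β * γ)⁻¹ p = q := by
      rw [← hq]
      change ((β * γ)⁻¹ * (β * γ)) q = q
      rw [inv_mul_cancel]; rfl
    rw [← this, mul_inv_rev]; rfl
  rw [h1]
  conv_lhs => rw [← hq]
  simp only [map_sub]
  have e1 : rot n γ (β p) = rot n γ (β p - p) + rot n γ p := by rw [map_sub]; abel
  have e2 : rot n β (γ p) = rot n β (γ p - p) + rot n β p := by rw [map_sub]; abel
  have e3 : γ (β q) = rot n γ (β q - p) + γ p := apply_eq_rot_add _ _ _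
  have e4 : β (γ q) = rot n β (γ q - p) + β p := apply_eq_rot_add _ _ _
  have e5 : β q = rot n β (q - p) + β p := apply_eq_rot_add _ _ _
  have e6 : γ q = rot n γ (q - p) + γ p := apply_eq_rot_add _ _ _
  rw [e3, e4, e5, e6]
  simp only [map_sub, map_add]
  abel

/-! ### Bieberbach's theorem -/

/-- A sequence in a finite set has a term with every property shared by the values which it takes
infinitely often. -/
theorem exists_of_frequently_eq {ι : Type*} (S : Set ι) (hS : S.Finite) (c : ℕ → ι)
    (hc : ∀ k, c k ∈ S) (Q : ι → Prop) (hQ : ∀ s, (∀ N : ℕ, ∃ k ≥ N, c k = s) → Q s) :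
    ∃ k, Q (c k) := by
  have : Finite S := hS
  obtain ⟨s, hs⟩ := Finite.exists_infinite_fiber (fun k => (⟨c k, hc k⟩ : S))
  have hinf : ((fun k => (⟨c k, hc k⟩ : S)) ⁻¹' {s}).Infinite := Set.infinite_coe_iff.1 hs
  obtain ⟨k, hk⟩ := hinf.nonempty
  refine ⟨k, ?_⟩
  have hk' : c k = s := congrArg Subtype.val hk
  rw [hk']
  refine hQ _ fun N => ?_
  obtain ⟨m, hm, hNm⟩ := hinf.exists_gt N
  exact ⟨m, hNm.le, congrArg Subtype.val hm⟩

theorem nonpos_of_forall_pow {a C : ℝ} (h : ∀ N : ℕ, ∃ k ≥ N, a ≤ (1 / 4) ^ k * C) (hC : 0 ≤ C) :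
    a ≤ 0 := by
  have ht : Filter.Tendsto (fun N : ℕ => (1 / 4 : ℝ) ^ N * C) Filter.atTop (nhds (0 * C)) :=
    (tendsto_pow_atTop_nhds_zero_of_lt_one (by norm_num) (by norm_num)).mul_const C
  rw [zero_mul] at ht
  refine ge_of_tendsto' ht fun N => ?_
  obtain ⟨k, hk, hak⟩ := h N
  refine hak.trans ?_
  gcongr ?_ * C
  exact pow_le_pow_of_le_one (by norm_num) (by norm_num) hk

/-- Elements of `Γ` with linear part near the identity have commuting linear parts. -/
theorem rot_commute_of_isNear (hfin : FiniteDisplacement Γ p) {γ β : EucIsom n} (hγ : γ ∈ Γ)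
    (hβ : β ∈ Γ) (hg : IsNear (1 / 8) (rot n γ)) (hh : IsNear (1 / 2) (rot n β)) :
    ⁅rot n γ, rot n β⁆ = 1 := by
  let c : ℕ → EucIsom n := fun k => (fun δ => ⁅γ, δ⁆)^[k] β
  have hc0 : c 0 = β := rfl
  have hcs : ∀ k, c (k + 1) = ⁅γ, c k⁆ := fun k => Function.iterate_succ_apply' _ _ _
  have hmem : ∀ k, c k ∈ Γ := by
    intro k
    induction k with
    | zero => exact hβ
    | succ k ih =>
      rw [hcs, commutatorElement_def]
      exact Γ.mul_mem (Γ.mul_mem (Γ.mul_mem hγ ih) (Γ.inv_mem hγ)) (Γ.inv_mem ih)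
  have hrot : ∀ k, rot n (c (k + 1)) = ⁅rot n γ, rot n (c k)⁆ := fun k => by
    rw [hcs, map_commutatorElement]
  have hnear : ∀ k, IsNear ((1 / 4) ^ k * (1 / 2)) (rot n (c k)) := by
    intro k
    induction k with
    | zero => rwa [pow_zero, one_mul, hc0]
    | succ k ih =>
      rw [hrot]
      refine (hg.commutator (by norm_num) (by positivity) ih).mono ?_
      rw [pow_succ]; linarith
  have hhalf : ∀ k, IsNear (1 / 2) (rot n (c k)) := fun k => (hnear k).mono (by
    have := pow_le_one₀ (n := k) (by norm_num : (0 : ℝ) ≤ 1 / 4) (by norm_num)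
    linarith)
  -- With `d` the displacement of `c k` and `D` that of `γ`, the next one is at most `d / 4 + 5 * D
  -- / 8`, so the bound persists.
  have hdisp : ∀ k, ‖c k p - p‖ ≤ ‖β p - p‖ + 2 * ‖γ p - p‖ := by
    intro k
    induction k with
    | zero => rw [hc0]; linarith [norm_nonneg (γ p - p)]
    | succ k ih =>
      obtain ⟨q, hq⟩ : ∃ q, c k (γ q) = p :=
        ((c k).surjective.comp γ.surjective) p
      have hqp : ‖q - p‖ ≤ ‖c k p - p‖ + ‖γ p - p‖ := by
        have h1 : ‖q - p‖ = ‖p - c k (γ p)‖ := by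
          have h0 : ‖c k (γ q) - c k (γ p)‖ = ‖q - p‖ := by
            rw [← rot_sub, LinearIsometryEquiv.norm_map, ← rot_sub, LinearIsometryEquiv.norm_map]
          rw [← h0, hq]
        have h2 : p - c k (γ p) = -((c k p - p) + rot n (c k) (γ p - p)) := by
          rw [rot_sub]; abel
        rw [h1, h2, norm_neg]
        refine (norm_add_le _ _).trans ?_
        rw [LinearIsometryEquiv.norm_map]
      rw [hcs, commutator_displacement γ (c k) p q hq]
      have h1 := hg (c k p - p)
      have h2 := hhalf k (γ p - p)
      have h3 := norm_commutator_apply_le (by norm_num) (by norm_num) hg (hhalf k) (q - p)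
      have h4 := norm_add_le ((rot n γ (c k p - p) - (c k p - p)) -
        (rot n (c k) (γ p - p) - (γ p - p)))
        (rot n γ (rot n (c k) (q - p)) - rot n (c k) (rot n γ (q - p)))
      have h5 := norm_sub_le (rot n γ (c k p - p) - (c k p - p))
        (rot n (c k) (γ p - p) - (γ p - p))
      have h6 := norm_nonneg (β p - p)
      linarith [norm_nonneg (γ p - p)]
  -- A value taken infinitely often has linear part arbitrarily near the identity, hence equal to
  -- it.
  obtain ⟨k, hk⟩ := exists_of_frequently_eq _ (hfin (‖β p - p‖ + 2 * ‖γ p - p‖)) c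
    (fun k => ⟨hmem k, hdisp k⟩) (fun δ => rot n δ = 1) (by
      intro δ hδ
      ext1 x
      refine sub_eq_zero.1 (norm_le_zero_iff.1
        (nonpos_of_forall_pow (C := 1 / 2 * ‖x‖) (fun N => ?_) (by positivity)))
      obtain ⟨k, hk, rfl⟩ := hδ N
      exact ⟨k, hk, (hnear k x).trans_eq (by ring)⟩)
  -- If the linear part of `c (k + 2)` is trivial, that of `γ` commutes with its commutator with
  -- that of `c k`. The descent stops at `c 1`, since `β` itself may rotate.
  have hdesc : ∀ k, rot n (c (k + 1)) = 1 → rot n (c 1) = 1 := by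
    intro k
    induction k with
    | zero => exact id
    | succ k ih =>
      intro hk
      refine ih ?_
      rw [hrot] at hk ⊢
      rw [hrot] at hk
      exact commutator_eq_one_of_commute (by norm_num) (hhalf k)
        (commutatorElement_eq_one_iff_commute.1 hk)
  rw [← hc0, ← hrot]
  refine hdesc k ?_
  rw [hrot, hk, commutatorElement_one_right]

/-- Elements of `Γ` with linear part near the identity commute with the translations in `Γ`. -/
theorem rot_apply_eq_of_isNear (hfin : FiniteDisplacement Γ p) {γ : EucIsom n} (hγ : γ ∈ Γ)
    (hg : IsNear (1 / 8) (rot n γ)) {w : Euc n} (hw : w ∈ translations Γ) : rot n γ w = w := by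
  let c : ℕ → Euc n := fun k => (fun v => rot n γ v - v)^[k] w
  have hcs : ∀ k, c (k + 1) = rot n γ (c k) - c k := fun k => Function.iterate_succ_apply' _ _ _
  have hmem : ∀ k, c k ∈ translations Γ := by
    intro k
    induction k with
    | zero => exact hw
    | succ k ih => rw [hcs]; exact sub_mem (rot_apply_mem_translations hγ ih) ih
  have hnorm : ∀ k, ‖c k‖ ≤ (1 / 4) ^ k * ‖w‖ := by
    intro k
    induction k with
    | zero => simp [c]
    | succ k ih =>
      rw [hcs, pow_succ]
      have := hg (c k)
      linarith [norm_nonneg (c k)]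
  obtain ⟨k, hk⟩ := exists_of_frequently_eq _ (hfin ‖w‖) (fun k => transl (c k))
    (fun k => ⟨hmem k, by
      rw [transl_apply, add_sub_cancel_right]
      refine (hnorm k).trans ?_
      have := pow_le_one₀ (n := k) (by norm_num : (0 : ℝ) ≤ 1 / 4) (by norm_num)
      nlinarith [norm_nonneg w]⟩) (fun δ => δ p - p = 0) (by
      intro δ hδ
      refine norm_le_zero_iff.1 (nonpos_of_forall_pow (C := ‖w‖) (fun N => ?_) (norm_nonneg _))
      obtain ⟨k, hk, rfl⟩ := hδ N
      refine ⟨k, hk, ?_⟩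
      rw [transl_apply, add_sub_cancel_right]
      exact hnorm k)
  rw [transl_apply, add_sub_cancel_right] at hk
  have hdesc : ∀ k, c (k + 1) = 0 → c 1 = 0 := by
    intro k
    induction k with
    | zero => exact id
    | succ k ih =>
      intro hk
      refine ih ?_
      rw [hcs] at hk ⊢
      rw [hcs] at hk
      rw [fixed_of_fixed_sub _ (sub_eq_zero.1 hk), sub_self]
  refine sub_eq_zero.1 (hdesc k ?_)
  rw [hcs, hk, map_zero, sub_zero]

/-- If `γ ∈ Γ` has linear part near the identity, then its linear part minus the identity has
square zero in the direction of displacements, up to a bounded error. -/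
theorem rot_sub_sq_eq (hfin : FiniteDisplacement Γ p) {γ β : EucIsom n} (hγ : γ ∈ Γ)
    (hβ : β ∈ Γ) (hg : IsNear (1 / 8) (rot n γ)) (hh : IsNear (1 / 2) (rot n β)) :
    rot n γ (rot n γ (β p - p) - (β p - p)) - (rot n γ (β p - p) - (β p - p)) =
      rot n γ (rot n β (γ p - p) - (γ p - p)) - (rot n β (γ p - p) - (γ p - p)) := by
  have hcomm := rot_commute_of_isNear hfin hγ hβ hg hh
  obtain ⟨q, hq⟩ : ∃ q, β (γ q) = p := (β.surjective.comp γ.surjective) p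
  have hd := commutator_displacement γ β p q hq
  have hgh : rot n γ (rot n β (q - p)) = rot n β (rot n γ (q - p)) :=
    DFunLike.congr_fun (commutatorElement_eq_one_iff_mul_comm.1 hcomm) (q - p)
  rw [hgh, sub_self, add_zero] at hd
  -- The linear parts commute, so the commutator is a translation, and `rot n γ` fixes its vector.
  have hmem : ⁅γ, β⁆ p - p ∈ translations Γ := by
    refine sub_mem_translations ?_ (by rw [map_commutatorElement, hcomm]) p
    rw [commutatorElement_def]
    exact Γ.mul_mem (Γ.mul_mem (Γ.mul_mem hγ hβ) (Γ.inv_mem hγ)) (Γ.inv_mem hβ)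
  have := rot_apply_eq_of_isNear hfin hγ hg hmem
  rw [hd, map_sub] at this
  rw [sub_eq_sub_iff_sub_eq_sub]
  exact this

/-- A sequence of linear isometries of Euclidean space has a subsequence whose terms are close to
each other. -/
theorem exists_subseq_isNear (h : ℕ → (Euc n ≃ₗᵢ[ℝ] Euc n)) {r : ℝ} (hr : 0 < r) :
    ∃ φ : ℕ → ℕ, StrictMono φ ∧ ∃ j, ∀ i ≥ j, IsNear r (h (φ i) * (h (φ j))⁻¹) := by
  let T : ℕ → (Euc n →L[ℝ] Euc n) := fun j => (h j : Euc n →L[ℝ] Euc n)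
  have hT : ∀ j, T j ∈ Metric.closedBall (0 : Euc n →L[ℝ] Euc n) 1 := fun j => by
    rw [mem_closedBall_zero_iff]
    refine ContinuousLinearMap.opNorm_le_bound _ zero_le_one fun x => ?_
    rw [one_mul]
    exact ((h j).norm_map x).le
  obtain ⟨L, -, φ, hφ, hL⟩ := (isCompact_closedBall (0 : Euc n →L[ℝ] Euc n) 1).tendsto_subseq hT
  obtain ⟨j, hj⟩ := Metric.cauchySeq_iff'.1 hL.cauchySeq r hr
  refine ⟨φ, hφ, j, fun i hi x => ?_⟩
  obtain ⟨y, rfl⟩ := (h (φ j)).surjective x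
  have e : (h (φ i) * (h (φ j))⁻¹) (h (φ j) y) - h (φ j) y = (T (φ i) - T (φ j)) y := by
    change h (φ i) (((h (φ j))⁻¹ * h (φ j)) y) - h (φ j) y = h (φ i) y - h (φ j) y
    rw [inv_mul_cancel]; rfl
  rw [e, (h (φ j)).norm_map]
  refine (ContinuousLinearMap.le_opNorm _ _).trans ?_
  gcongr
  rw [← dist_eq_norm]
  exact (hj i hi).le

/-- **Bieberbach's theorem**, first part: an element of a discrete cocompact group of isometries
whose linear part is near the identity is a translation. -/
theorem rot_eq_one_of_isNear (hfin : FiniteDisplacement Γ p) (hco : CoboundedOrbit Γ p)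
    {γ : EucIsom n} (hγ : γ ∈ Γ) (hg : IsNear (1 / 8) (rot n γ)) : rot n γ = 1 := by
  ext1 u
  obtain ⟨d, hd⟩ := hco
  -- Orbit points follow the ray in direction `u`. Composing with a fixed inverse from a convergent
  -- subsequence brings the linear parts near the identity and changes displacements by at most `C`.
  choose δ hδ hδd using fun j : ℕ => hd (p + (j : ℝ) • u)
  obtain ⟨φ, hφ, j, hj⟩ := exists_subseq_isNear (fun i => rot n (δ i)) (r := 1 / 2) (by norm_num)
  set C := ‖(δ (φ j))⁻¹ p - p‖
  let T : Euc n →ₗ[ℝ] Euc n := (rot n γ).toLinearEquiv.toLinearMap - LinearMap.id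
  have hTa : ∀ x, T x = rot n γ x - x := fun x => rfl
  have hT : ∀ x, ‖T x‖ ≤ 2 * ‖x‖ := fun x => by
    rw [hTa]
    refine (norm_sub_le _ _).trans ?_
    rw [LinearIsometryEquiv.norm_map]; linarith
  have hTT : ∀ x, ‖T (T x)‖ ≤ 4 * ‖x‖ := fun x => by linarith [hT x, hT (T x)]
  have key : ∀ N : ℕ, N * ‖T (T u)‖ ≤ 4 * ‖γ p - p‖ + 4 * (d + C) := by
    intro N
    set i := max N j
    set β := δ (φ i) * (δ (φ j))⁻¹
    have hβ : β ∈ Γ := Γ.mul_mem (hδ _) (Γ.inv_mem (hδ _))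
    have hh : IsNear (1 / 2) (rot n β) := by
      have := hj i (le_max_right _ _)
      rwa [← map_inv, ← map_mul] at this
    have h1 := rot_sub_sq_eq hfin hγ hβ hg hh
    have h2 : ‖T (T (β p - p))‖ ≤ 4 * ‖γ p - p‖ := by
      have e : T (T (β p - p)) = T (rot n β (γ p - p) - (γ p - p)) := h1
      have h3 := norm_sub_le (rot n β (γ p - p)) (γ p - p)
      rw [LinearIsometryEquiv.norm_map] at h3
      rw [e]
      linarith [hT (rot n β (γ p - p) - (γ p - p))]
    have h4 : ‖β p - p - (φ i : ℝ) • u‖ ≤ d + C := by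
      have e : β p - p - (φ i : ℝ) • u =
          (δ (φ i) p - (p + (φ i : ℝ) • u)) + (β p - δ (φ i) p) := by abel
      have h5 : ‖β p - δ (φ i) p‖ = C := by
        change ‖δ (φ i) ((δ (φ j))⁻¹ p) - δ (φ i) p‖ = C
        rw [← rot_sub, LinearIsometryEquiv.norm_map]
      rw [e]
      exact (norm_add_le _ _).trans (add_le_add (hδd _) h5.le)
    have h6 : (φ i : ℝ) • T (T u) = T (T (β p - p)) - T (T (β p - p - (φ i : ℝ) • u)) := by
      rw [← map_sub, ← map_sub, sub_sub_cancel, map_smul, map_smul]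
    have h7 : (φ i : ℝ) * ‖T (T u)‖ ≤ 4 * ‖γ p - p‖ + 4 * (d + C) := by
      have : ‖(φ i : ℝ) • T (T u)‖ = (φ i : ℝ) * ‖T (T u)‖ := by rw [norm_smul]; simp
      rw [← this, h6]
      refine (norm_sub_le _ _).trans (add_le_add h2 ?_)
      linarith [hTT (β p - p - (φ i : ℝ) • u)]
    refine le_trans ?_ h7
    gcongr
    exact (le_max_left N j).trans (hφ.id_le _)
  exact fixed_of_fixed_sub _
    (sub_eq_zero.1 (norm_le_zero_iff.1 (nonpos_of_forall_nat_mul_le key)))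

/-- **Bieberbach's theorem**: the point group of a discrete cocompact group of isometries of
Euclidean space is finite. -/
theorem finite_pointGroup (hfin : FiniteDisplacement Γ p) (hco : CoboundedOrbit Γ p) :
    Finite (Γ.map (rot n)) := by
  by_contra hinf
  rw [not_finite_iff_infinite] at hinf
  let f := Infinite.natEmbedding (Γ.map (rot n))
  obtain ⟨φ, hφ, j, hj⟩ :=
    exists_subseq_isNear (fun i => (f i : Euc n ≃ₗᵢ[ℝ] Euc n)) (r := 1 / 8) (by norm_num)
  have h1 := hj (j + 1) (Nat.le_succ j)
  obtain ⟨γ, hγ, hγe⟩ := (f (φ (j + 1)) * (f (φ j))⁻¹).2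
  have h2 := rot_eq_one_of_isNear hfin hco hγ (by rw [hγe]; exact h1)
  rw [hγe] at h2
  have h3 : f (φ (j + 1)) = f (φ j) := mul_inv_eq_one.1 (Subtype.ext h2)
  exact absurd (hφ.injective (f.injective h3)) (Nat.succ_ne_self j)

/-! ### Discreteness and cocompactness of an infratorus group -/

theorem IsInfratorus.finiteDisplacement (h : IsInfratorus Γ) (p : Euc n) :
    FiniteDisplacement Γ p := by
  intro R
  have := h.properlyDiscontinuous.finite_disjoint_inter_image (isCompact_singleton (x := p))
    (isCompact_closedBall p R)
  refine (this.image Subtype.val).subset ?_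
  rintro γ ⟨hγ, hR⟩
  refine ⟨⟨γ, hγ⟩, ⟨γ p, ⟨p, rfl, rfl⟩, ?_⟩, rfl⟩
  rwa [Metric.mem_closedBall, dist_eq_norm]

/-- The images of balls about `p` form an increasing open cover of the compact orbit space, so one
ball already meets every orbit. -/
theorem IsInfratorus.coboundedOrbit (h : IsInfratorus Γ) (p : Euc n) : CoboundedOrbit Γ p := by
  have := h.compact
  have : ContinuousConstSMul Γ (Euc n) := ⟨fun γ => (γ : EucIsom n).continuous⟩
  have hopen : IsOpenMap (proj Γ) := isOpenMap_quotient_mk'_mul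
  obtain ⟨N, hN⟩ := (isCompact_univ (X := OrbitSpace Γ)).elim_directed_cover
    (fun N : ℕ => proj Γ '' Metric.ball p N) (fun N => hopen _ Metric.isOpen_ball)
    (fun x _ => by
      obtain ⟨y, rfl⟩ := Quotient.exists_rep x
      obtain ⟨N, hN⟩ := exists_nat_gt (dist y p)
      exact Set.mem_iUnion.2 ⟨N, y, hN, rfl⟩)
    (directed_of_isDirected_le fun a b hab =>
      Set.image_mono (Metric.ball_subset_ball (by exact_mod_cast hab)))
  refine ⟨N, fun x => ?_⟩
  obtain ⟨y, hy, hyx⟩ := hN (Set.mem_univ (proj Γ x))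
  obtain ⟨γ, hγ⟩ := (Quotient.exact hyx.symm : x ∈ MulAction.orbit Γ y)
  refine ⟨γ, γ.2, ?_⟩
  have hγ' : (γ : EucIsom n) y = x := hγ
  rw [← hγ', ← rot_sub, LinearIsometryEquiv.norm_map, ← dist_eq_norm, dist_comm]
  exact (Metric.mem_ball.1 hy).le

/-- The translations in a discrete group of isometries form a discrete group. -/
theorem discreteTopology_translations (hfin : FiniteDisplacement Γ p) :
    DiscreteTopology (translations Γ).toIntSubmodule := by
  refine discreteTopology_of_isOpen_singleton_zero ?_
  have hb : (Metric.ball (0 : (translations Γ).toIntSubmodule) 1).Finite := by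
    refine Set.Finite.of_finite_image (f := fun v => transl (v : Euc n))
      ((hfin 1).subset ?_) ?_
    · rintro _ ⟨v, hv, rfl⟩
      refine ⟨v.2, ?_⟩
      rw [transl_apply, add_sub_cancel_right]
      exact (mem_ball_zero_iff.1 hv).le
    · intro v _ w _ hvw
      have := DFunLike.congr_fun hvw (0 : Euc n)
      simpa using this
  have h0 : ({0} : Set (translations Γ).toIntSubmodule) =
      Metric.ball 0 1 \ (Metric.ball 0 1 \ {0}) := by
    rw [Set.sdiff_sdiff_right_self, eq_comm, Set.inter_eq_right, Set.singleton_subset_iff]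
    exact Metric.mem_ball_self one_pos
  rw [h0]
  exact Metric.isOpen_ball.sdiff (hb.subset Set.sdiff_subset).isClosed

/-! ### Hyperbolic affine maps and rationality of displacements -/

/-- No positive power of a hyperbolic linear map has the eigenvalue `1`. -/
theorem IsHyperbolic.eq_zero_of_pow_apply_eq {T : Euc n →ₗ[ℝ] Euc n} (hT : IsHyperbolic T) {k : ℕ}
    (hk : 0 < k) {v : Euc n} (hv : (T ^ k) v = v) : v = 0 := by
  -- A common complex root would be an eigenvalue of modulus `1`. Bézout and Cayley–Hamilton then
  -- make `T ^ k - 1` injective.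
  have hco : IsCoprime (Polynomial.X ^ k - 1 : Polynomial ℝ) T.charpoly := by
    rw [Polynomial.isCoprime_iff_aeval_ne_zero_of_isAlgClosed ℝ ℂ]
    intro z
    by_contra! h
    obtain ⟨h1, h2⟩ := h
    refine hT z ?_ ?_
    · rwa [Polynomial.IsRoot, Polynomial.eval_map_algebraMap]
    · refine Complex.norm_eq_one_of_pow_eq_one (n := k) ?_ hk.ne'
      simpa [sub_eq_zero] using h1
  obtain ⟨a, b, hab⟩ := hco
  have h := congrArg (fun q => Polynomial.aeval T q v) hab
  simpa [LinearMap.aeval_self_charpoly, hv] using h.symm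

theorem affine_sub (F : Euc n ≃ᵃ[ℝ] Euc n) (x y : Euc n) :
    F.linear (x - y) = F x - F y := F.toAffineMap.linearMap_vsub x y

/-- An affine map with hyperbolic linear part has a fixed point. -/
theorem IsHyperbolic.exists_fixed {F : Euc n ≃ᵃ[ℝ] Euc n}
    (hF : IsHyperbolic (F.linear : Euc n →ₗ[ℝ] Euc n)) : ∃ p, F p = p := by
  set T := (F.linear : Euc n →ₗ[ℝ] Euc n)
  have hinj : Function.Injective (1 - T : Euc n →ₗ[ℝ] Euc n) := by
    rw [← LinearMap.ker_eq_bot, LinearMap.ker_eq_bot']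
    intro v hv
    refine hF.eq_zero_of_pow_apply_eq one_pos ?_
    rw [pow_one]
    exact (sub_eq_zero.1 hv).symm
  obtain ⟨p, hp⟩ := LinearMap.surjective_of_injective hinj (F 0)
  refine ⟨p, ?_⟩
  have h1 : F p = T p + F 0 := by
    have h0 : F p - F 0 = T (p - 0) := (affine_sub F p 0).symm
    rw [sub_zero] at h0
    rw [← h0, sub_add_cancel]
  rw [h1, ← hp]
  simp

theorem ConjMapsInto.exists_conj {F : Euc n ≃ᵃ[ℝ] Euc n} (hF : ConjMapsInto Γ F) {γ : EucIsom n}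
    (hγ : γ ∈ Γ) : ∃ γ' ∈ Γ, ∀ x, γ' (F x) = F (γ x) := by
  obtain ⟨γ', hγ', h⟩ := hF γ hγ
  exact ⟨γ', hγ', fun x => by rw [← h (F x), AffineEquiv.symm_apply_apply]⟩

theorem rot_linear_apply {F : Euc n ≃ᵃ[ℝ] Euc n} {γ γ' : EucIsom n}
    (h : ∀ x, γ' (F x) = F (γ x)) (v : Euc n) :
    rot n γ' (F.linear v) = F.linear (rot n γ v) := by
  obtain ⟨x, rfl⟩ : ∃ x, x - 0 = v := ⟨v, sub_zero v⟩
  rw [affine_sub, rot_sub, rot_sub, affine_sub, h, h]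

/-- Some power of the linear part of an affine map normalizing `Γ` centralizes the point group. -/
theorem exists_pow_commute [Finite (Γ.map (rot n))] {F : Euc n ≃ᵃ[ℝ] Euc n}
    (hF : ConjMapsInto Γ F) : ∃ k > 0, ∀ γ ∈ Γ, ∀ v,
      rot n γ (((F.linear : Euc n →ₗ[ℝ] Euc n) ^ k) v) =
        ((F.linear : Euc n →ₗ[ℝ] Euc n) ^ k) (rot n γ v) := by
  set T := (F.linear : Euc n →ₗ[ℝ] Euc n)
  have hex : ∀ h : Γ.map (rot n), ∃ h' : Γ.map (rot n), ∀ v,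
      (h' : Euc n ≃ₗᵢ[ℝ] Euc n) (T v) = T ((h : Euc n ≃ₗᵢ[ℝ] Euc n) v) := by
    rintro ⟨_, γ, hγ, rfl⟩
    obtain ⟨γ', hγ', h⟩ := hF.exists_conj hγ
    exact ⟨⟨_, γ', hγ', rfl⟩, rot_linear_apply h⟩
  choose c hc using hex
  have hinj : Function.Injective c := by
    intro a b hab
    ext1
    ext1 v
    have := hc a v
    rw [hab, hc b v] at this
    exact (F.linear.injective this).symm
  -- Conjugation by `T` permutes the finite point group; the order of this permutation serves as
  -- `k`.
  let σ : Equiv.Perm (Γ.map (rot n)) := Equiv.ofBijective c (Finite.injective_iff_bijective.1 hinj)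
  have hpow : ∀ j : ℕ, ∀ h : Γ.map (rot n), ∀ v,
      ((σ ^ j) h : Euc n ≃ₗᵢ[ℝ] Euc n) ((T ^ j) v) = (T ^ j) ((h : Euc n ≃ₗᵢ[ℝ] Euc n) v) := by
    intro j
    induction j with
    | zero => intro h v; rfl
    | succ j ih =>
      intro h v
      rw [pow_succ', pow_succ', Equiv.Perm.mul_apply]
      exact (hc _ _).trans (congrArg T (ih h v))
  refine ⟨orderOf σ, orderOf_pos σ, fun γ hγ v => ?_⟩
  have := hpow (orderOf σ) ⟨_, γ, hγ, rfl⟩ v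
  rwa [pow_orderOf_eq_one] at this

/-- The witness is the conjugate of `γ` by `F ^ j`; displacements transform linearly because `F`
fixes the base point `p`. -/
theorem exists_pow_conj {F : Euc n ≃ᵃ[ℝ] Euc n} (hF : ConjMapsInto Γ F) (hp : F p = p)
    {γ : EucIsom n} (hγ : γ ∈ Γ) (j : ℕ) : ∃ γ' ∈ Γ,
      γ' p - p = ((F.linear : Euc n →ₗ[ℝ] Euc n) ^ j) (γ p - p) ∧
      ∀ v, rot n γ' (((F.linear : Euc n →ₗ[ℝ] Euc n) ^ j) v) =
        ((F.linear : Euc n →ₗ[ℝ] Euc n) ^ j) (rot n γ v) := by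
  induction j with
  | zero => exact ⟨γ, hγ, rfl, fun _ => rfl⟩
  | succ j ih =>
    obtain ⟨γ', hγ', h1, h2⟩ := ih
    obtain ⟨γ'', hγ'', h⟩ := hF.exists_conj hγ'
    refine ⟨γ'', hγ'', ?_, fun v => ?_⟩
    · rw [pow_succ', Module.End.mul_apply, ← h1]
      have := h p
      rw [hp] at this
      rw [this]
      exact (congrArg (F (γ' p) - ·) hp.symm).trans (affine_sub F _ _).symm
    · rw [pow_succ', Module.End.mul_apply, Module.End.mul_apply, ← h2]
      exact rot_linear_apply h _

theorem linear_mem_translations {F : Euc n ≃ᵃ[ℝ] Euc n} (hF : ConjMapsInto Γ F) {v : Euc n}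
    (hv : v ∈ translations Γ) : F.linear v ∈ translations Γ := by
  obtain ⟨γ', hγ', h⟩ := hF.exists_conj hv
  have e : transl (F.linear v) = γ' := by
    ext1 x
    obtain ⟨y, rfl⟩ := F.surjective x
    rw [h, transl_apply, transl_apply]
    exact (F.map_vadd y v).symm
  rw [mem_translations, e]
  exact hγ'

theorem pow_linear_mem_translations {F : Euc n ≃ᵃ[ℝ] Euc n} (hF : ConjMapsInto Γ F) {v : Euc n}
    (hv : v ∈ translations Γ) (j : ℕ) :
    ((F.linear : Euc n →ₗ[ℝ] Euc n) ^ j) v ∈ translations Γ := by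
  induction j with
  | zero => exact hv
  | succ j ih =>
    rw [pow_succ', Module.End.mul_apply]
    exact linear_mem_translations hF ih

/-- An injective endomorphism of a finitely generated free abelian group has a range containing a
positive multiple of every element. -/
theorem exists_nsmul_mem_range {M : Type*} [AddCommGroup M] [Module.Free ℤ M] [Module.Finite ℤ M]
    (f : M →ₗ[ℤ] M) (hf : Function.Injective f) : ∃ N : ℕ, 0 < N ∧
      ∀ x, N • x ∈ LinearMap.range f := by
  have : Finite (M ⧸ LinearMap.range f) :=
    Submodule.finiteQuotientOfFreeOfRankEq _ (LinearEquiv.ofInjective f hf).finrank_eq.symm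
  refine ⟨Nat.card (M ⧸ LinearMap.range f), Nat.card_pos, fun x => ?_⟩
  have h : Nat.card (M ⧸ LinearMap.range f) •
      (Submodule.Quotient.mk x : M ⧸ LinearMap.range f) = 0 :=
    card_nsmul_eq_zero'
  rwa [← Submodule.Quotient.mk_smul, Submodule.Quotient.mk_eq_zero] at h

/-- With respect to a fixed point of a hyperbolic affine map normalizing `Γ`, the translation parts
of the elements of `Γ` are rational with bounded denominators. -/
theorem exists_nsmul_displacement_mem (hfin : FiniteDisplacement Γ p) (hco : CoboundedOrbit Γ p)
    {F : Euc n ≃ᵃ[ℝ] Euc n} (hF : ConjMapsInto Γ F)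
    (hyp : IsHyperbolic (F.linear : Euc n →ₗ[ℝ] Euc n)) (hp : F p = p) :
    ∃ N : ℕ, 0 < N ∧ ∀ γ ∈ Γ, N • (γ p - p) ∈ translations Γ := by
  have := finite_pointGroup hfin hco
  have := discreteTopology_translations hfin
  obtain ⟨k, hk, hcomm⟩ := exists_pow_commute hF
  set T := (F.linear : Euc n →ₗ[ℝ] Euc n)
  have hinj : ∀ v, (T ^ k) v - v = 0 → v = 0 := fun v hv =>
    hyp.eq_zero_of_pow_apply_eq hk (sub_eq_zero.1 hv)
  let B : Euc n →ₗ[ℤ] Euc n := (T ^ k - 1).restrictScalars ℤ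
  have hB : ∀ v, B v = (T ^ k) v - v := fun v => rfl
  let f : (translations Γ).toIntSubmodule →ₗ[ℤ] (translations Γ).toIntSubmodule :=
    B.restrict fun v hv => sub_mem (pow_linear_mem_translations hF hv k) hv
  have hf : Function.Injective f := by
    rw [← LinearMap.ker_eq_bot, LinearMap.ker_eq_bot']
    intro v hv
    exact Subtype.ext (hinj v (congrArg Subtype.val hv))
  obtain ⟨N, hN, hNf⟩ := exists_nsmul_mem_range f hf
  refine ⟨N, hN, fun γ hγ => ?_⟩
  obtain ⟨γ', hγ', h1, h2⟩ := exists_pow_conj hF hp hγ k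
  have hrot : rot n γ' = rot n γ := by
    ext1 x
    have hinjk : Function.Injective (T ^ k) := by
      rw [Module.End.coe_pow]
      exact F.linear.injective.iterate k
    obtain ⟨v, rfl⟩ := LinearMap.surjective_of_injective hinjk x
    rw [h2, hcomm γ hγ]
  -- `γ' * γ⁻¹` has trivial linear part and is the translation by this vector.
  have hmem : B (γ p - p) ∈ translations Γ := by
    have h3 := sub_mem_translations (Γ.mul_mem hγ' (Γ.inv_mem hγ))
      (by rw [map_mul, map_inv, hrot, mul_inv_cancel]) (γ p)
    have h4 : (γ' * γ⁻¹) (γ p) = γ' p := by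
      change ((γ' * γ⁻¹) * γ) p = γ' p
      rw [inv_mul_cancel_right]
    rw [h4] at h3
    rw [hB, ← h1]
    convert h3 using 1
    abel
  obtain ⟨w, hw⟩ := hNf ⟨_, hmem⟩
  have hw' : B w = N • B (γ p - p) := congrArg Subtype.val hw
  have h5 : N • (γ p - p) - w = 0 := hinj _ (by rw [← hB, map_sub, map_nsmul, hw', sub_self])
  rw [sub_eq_zero.1 h5]
  exact w.2

/-! ### Homotheties and the induced map -/

/-- The homothety with centre `p` and ratio `m`. -/
noncomputable def dilation (p : Euc n) (m : ℝ) (hm : m ≠ 0) : Euc n ≃ᵃ[ℝ] Euc n :=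
  AffineEquiv.mk' (fun x => m • (x - p) + p) (LinearEquiv.smulOfNeZero ℝ (Euc n) m hm) p
    (fun x => by simp)

theorem dilation_apply (p : Euc n) (m : ℝ) (hm : m ≠ 0) (x : Euc n) :
    dilation p m hm x = m • (x - p) + p := rfl

theorem dilation_linear (p : Euc n) (m : ℝ) (hm : m ≠ 0) :
    ((dilation p m hm).linear : Euc n →ₗ[ℝ] Euc n) = m • 1 := rfl

theorem isExpanding_smul_one {m : ℝ} (hm : 1 < m) : IsExpanding (m • 1 : Euc n →ₗ[ℝ] Euc n) := by
  intro z hz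
  have e : (m • 1 : Euc n →ₗ[ℝ] Euc n) = 1 - (1 - m) • 1 := by module
  rw [e, LinearMap.charpoly_sub_smul, LinearMap.charpoly_one, Polynomial.IsRoot,
    Polynomial.eval_map_algebraMap] at hz
  have hz' : (z + (1 - m) - 1) ^ Module.finrank ℝ (Euc n) = 0 := by
    simpa [Polynomial.aeval_comp] using hz
  have hzm : z = (m : ℂ) := by linear_combination eq_zero_of_pow_eq_zero hz'
  rw [hzm, Complex.norm_real, Real.norm_eq_abs, abs_of_pos (by linarith)]
  exact hm

theorem isConformalMap_smul_one {m : ℝ} (hm : m ≠ 0) :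
    IsConformalMap (LinearMap.toContinuousLinearMap (m • 1 : Euc n →ₗ[ℝ] Euc n)) :=
  ⟨m, hm, LinearIsometry.id, rfl⟩

/-- The conjugate of `γ` keeps its linear part and has displacement `(N + 1) • (γ p - p)` at `p`, so
it differs from `γ` by the lattice translation `N • (γ p - p)`. -/
theorem conjMapsInto_dilation {N : ℕ} (hN : ∀ γ ∈ Γ, N • (γ p - p) ∈ translations Γ)
    (hm : (N + 1 : ℝ) ≠ 0) : ConjMapsInto Γ (dilation p (N + 1) hm) := by
  intro γ hγ
  refine ⟨transl (N • (γ p - p)) * γ, Γ.mul_mem (hN γ hγ) hγ, fun x => ?_⟩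
  obtain ⟨y, rfl⟩ := (dilation p (N + 1) hm).surjective x
  rw [AffineEquiv.symm_apply_apply, dilation_apply, dilation_apply]
  change _ = N • (γ p - p) + γ (((N : ℝ) + 1) • (y - p) + p)
  rw [apply_eq_rot_add γ (((N : ℝ) + 1) • (y - p) + p) p, add_sub_cancel_right, map_smul, rot_sub,
    ← Nat.cast_smul_eq_nsmul ℝ]
  module

/-- An affine map which conjugates `Γ` into itself induces a map of the orbit space. -/
theorem ConjMapsInto.exists_isInducedBy {F : Euc n ≃ᵃ[ℝ] Euc n} (hF : ConjMapsInto Γ F) :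
    ∃ f : OrbitSpace Γ → OrbitSpace Γ, IsInducedBy f F := by
  refine ⟨Quotient.map F ?_, fun x => rfl⟩
  rintro _ y ⟨γ, rfl⟩
  obtain ⟨γ', hγ', h⟩ := hF.exists_conj γ.2
  exact ⟨⟨γ', hγ'⟩, h y⟩

end FlatManifold

open FlatManifold in
theorem proposition4p2 (n : ℕ) (Γ : Subgroup (FlatManifold.EucIsom n))
    (hΓ : FlatManifold.IsInfratorus Γ)
    (L : FlatManifold.OrbitSpace Γ → FlatManifold.OrbitSpace Γ)
    (hL : FlatManifold.IsAnosovAutomorphism L) :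
    ∃ k : ℕ, 0 < k ∧ ∃ E : FlatManifold.OrbitSpace Γ → FlatManifold.OrbitSpace Γ,
      FlatManifold.IsConformalExpandingAffine E ∧
      Function.Commute (L^[k]) E ∧
      ∃ p : FlatManifold.OrbitSpace Γ,
        Function.IsFixedPt (L^[k]) p ∧ Function.IsFixedPt E p := by
  obtain ⟨F, hyp, hF, hLF⟩ := hL
  obtain ⟨p, hp⟩ := hyp.exists_fixed
  obtain ⟨N, hN, hNΓ⟩ := exists_nsmul_displacement_mem (hΓ.finiteDisplacement p)
    (hΓ.coboundedOrbit p) hF.1 hyp hp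
  have hN' : (0 : ℝ) < N := Nat.cast_pos.2 hN
  have hm : (N + 1 : ℝ) ≠ 0 := by positivity
  have hD := conjMapsInto_dilation hNΓ hm
  obtain ⟨E, hE⟩ := hD.exists_isInducedBy
  -- No power of `L` is needed: the homothety commutes with `F` itself. Positivity of `N` makes the
  -- ratio exceed `1`.
  refine ⟨1, one_pos, E, ⟨dilation p (N + 1) hm, ?_, ?_, hD, hE⟩, ?_, proj Γ p, ?_, ?_⟩
  · rw [dilation_linear]
    exact isExpanding_smul_one (by linarith)
  · rw [dilation_linear]
    exact isConformalMap_smul_one hm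
  · intro x
    obtain ⟨y, rfl⟩ : ∃ y, proj Γ y = x := Quotient.exists_rep x
    rw [Function.iterate_one, hE y, hLF, hLF, hE]
    congr 1
    have h1 : ∀ z, F z = F.linear (z - p) + p := fun z => by rw [affine_sub, hp]; abel
    rw [h1, h1 y, dilation_apply, dilation_apply, add_sub_cancel_right, add_sub_cancel_right,
      map_smul]
  · rw [Function.iterate_one, Function.IsFixedPt, hLF, hp]
  · rw [Function.IsFixedPt, hE, dilation_apply, sub_self, smul_zero, zero_add]
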